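/- Let $\mathcal{E}$ be an ellipse in the Euclidean plane $\mathbb{R}^2$. A triangular (3-periodic) orbit of the billiard inside $\mathcal{E}$ is a triple $(p_0,p_1,p_2)$ of pairwise distinct points of $\mathcal{E}$ such that, at each vertex $p_i$ (indices modulo $3$), the outgoing direction $p_{i+1}-p_i$ is a positive multiple of the mirror image of the incoming direction $p_i-p_{i-1}$ in the tangent line to $\mathcal{E}$ at $p_i$. Let $\mathcal{C}$ be the set of the circumcenters of all these triangles. If $\mathcal{E}$ is not a circle, then $\mathcal{C}$ is (the whole of) a nondegenerate ellipse. If $\mathcal{E}$ is a circle, then $\mathcal{C}$ is reduced to a single point. -/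

import Mathlib

namespace EllipticBilliard

/-- The Euclidean plane. -/
abbrev Plane : Type := EuclideanSpace ℝ (Fin 2)

/-- `S` is a (nondegenerate real) ellipse: for some center `c`, some orthonormal frame `e` and some
semi-axes `a, b > 0`, it is the curve `(x / a) ^ 2 + (y / b) ^ 2 = 1` in the coordinates `(x, y)` of
the frame centered at `c`. Circles are included. -/
def IsEllipse (S : Set Plane) : Prop :=
  ∃ (c : Plane) (e : OrthonormalBasis (Fin 2) ℝ Plane) (a b : ℝ), 0 < a ∧ 0 < b ∧
    S = {p | (e.repr (p - c) 0 / a) ^ 2 + (e.repr (p - c) 1 / b) ^ 2 = 1}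

/-- `S` is a circle of positive radius. -/
def IsCircle (S : Set Plane) : Prop :=
  ∃ (c : Plane) (r : ℝ), 0 < r ∧ S = Metric.sphere c r

/-- The direction of the tangent line to the curve `S` at `p`: the linear span of all tangent
vectors to `S` at `p`. -/
noncomputable def tangentDirection (S : Set Plane) (p : Plane) : Submodule ℝ Plane :=
  Submodule.span ℝ (tangentConeAt ℝ S p)

/-- The usual billiard law at `q`: a particle that comes straight from `p`, hits the curve `S` at
`q` and goes on straight to `r` does so with a velocity that is the mirror image, in the tangent
line to `S` at `q`, of its incoming velocity (angle before reflection = angle after reflection). -/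
def ReflectsAt (S : Set Plane) (p q r : Plane) : Prop :=
  SameRay ℝ ((tangentDirection S q).reflection (q - p)) (r - q)

/-- `p 0, …, p (n - 1)` is an `n`-periodic orbit of the billiard inside the closed convex curve `S`;
indices are cyclic (addition in `Fin n` is modulo `n`). -/
def IsPeriodicOrbit (S : Set Plane) (n : ℕ) [NeZero n] (p : Fin n → Plane) : Prop :=
  (∀ i, p i ∈ S) ∧ (∀ i, p i ≠ p (i + 1)) ∧ ∀ i, ReflectsAt S (p i) (p (i + 1)) (p (i + 1 + 1))

/-- The set of the circumcenters of all triangular (3-periodic) orbits of the billiard inside `S`.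
A triangle is an affinely independent triple; if `S` is an ellipse, this excludes no orbit, because
the three vertices are distinct and a line meets `S` in at most two points. -/
def circumcenters (S : Set Plane) : Set Plane :=
  {c | ∃ T : Affine.Simplex ℝ Plane 2, IsPeriodicOrbit S 3 T.points ∧ T.circumcenter = c}

end EllipticBilliard

/-!
Write the ellipse as `x + i y ↦ c + a x e₀ + b y e₁`, an affine image of the unit circle of `ℂ`.

In a billiard orbit, the product of the unit direction of a side with the normal
`(x / a, y / b)` at its ends is a constant, Joachimsthal's integral. For two points `z, w` of the
unit circle put `N = 1 - Re (z conj w)`. This is, up to sign, the product of the normal with the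
chord, and the squared length of the chord is `N (a² + b² - (a² - b²) Re (z w))`. The constancy of
the integral therefore means that `N = k (a² + b² - (a² - b²) Re (z w))` for each pair of vertices:
the three vertices are pairwise conjugate with respect to the conic `(1 - g) x² + (1 + g) y² = C`,
where `g = k (a² - b²)` and `C = 1 - k (a² + b²)` (`joachimsthal_of_orbit`,
`orbit_of_joachimsthal`).

A triple of distinct points of the unit circle that is self-polar in this sense satisfies
`s₁ = -g s₃`, `s₂ = -g` and `2 C = g² - 1` for its elementary symmetric functions `s₁, s₂, s₃`
(`symmetric_functions_of_selfPolar`). The last equation is quadratic in `k` with exactly one positive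
root, for which `|g| < 1`; so all orbits share the same `g`. The vertices are the
roots of `z³ + g λ z² - g z - λ`, with `λ = s₃` on the unit circle. Conversely, for each `λ` on the
unit circle the roots of this cubic are distinct and of modulus one, because they are the preimages
of `λ` under a Blaschke product of degree three, and they give an orbit (`exists_selfPolar`).

Divided by `z`, the real part of the cubic equation says that the vertices are equidistant from the
image of `λ = L₀ + i L₁` under `(a² - b²) ((1 - g) L₀ / (4 a), (1 + g) L₁ / (4 b))`
(`circumcenter_eq`). As `λ` runs over the unit circle, this point runs over an ellipse if `a ≠ b`.
In a circle, every inscribed triangle has the center of the circle as its circumcenter, and the same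
construction provides an orbit.
-/

namespace EllipticBilliard

open Complex ComplexConjugate Module
open scoped RealInnerProductSpace

/-! ### Self-polar triples of points of the unit circle -/

lemma mul_conj_of_norm_one {z : ℂ} (hz : ‖z‖ = 1) : z * conj z = 1 := by
  rw [mul_conj', hz]; norm_num

lemma re_sq_add_im_sq_of_norm_one {z : ℂ} (hz : ‖z‖ = 1) : z.re ^ 2 + z.im ^ 2 = 1 := by
  have h := Complex.sq_norm z
  rw [hz, normSq_apply] at h
  linarith

lemma norm_one_of_re_sq_add_im_sq {z : ℂ} (hz : z.re ^ 2 + z.im ^ 2 = 1) : ‖z‖ = 1 := by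
  have h := Complex.sq_norm z
  rw [normSq_apply] at h
  have : ‖z‖ ^ 2 = 1 := by linarith
  nlinarith [norm_nonneg z]

/-- Conjugacy with respect to the conic `(1 - g) x² + (1 + g) y² = C`, for two points of the unit
circle, as a polynomial relation between complex numbers. -/
lemma polar_iff {z w : ℂ} (hz : ‖z‖ = 1) (hw : ‖w‖ = 1) (g C : ℝ) :
    (1 - g) * (z.re * w.re) + (1 + g) * (z.im * w.im) = C ↔
      z ^ 2 + w ^ 2 - g * (z ^ 2 * w ^ 2 + 1) = 2 * C * (z * w) := by
  have hz' := mul_conj_of_norm_one hz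
  have hw' := mul_conj_of_norm_one hw
  have hz0 : z ≠ 0 := by rintro rfl; simp at hz
  have hw0 : w ≠ 0 := by rintro rfl; simp at hw
  have key : z ^ 2 + w ^ 2 - g * (z ^ 2 * w ^ 2 + 1) =
      2 * (((1 - g) * (z.re * w.re) + (1 + g) * (z.im * w.im) : ℝ) : ℂ) * (z * w) := by
    have e : 2 * (((1 - g) * (z.re * w.re) + (1 + g) * (z.im * w.im) : ℝ) : ℂ) =
        z * conj w + w * conj z - g * (z * w + conj z * conj w) := by
      apply Complex.ext <;> simp <;> ring
    rw [e]
    linear_combination (w ^ 2 * -1 + g * (w * conj w)) * hz' + (-z ^ 2 + g) * hw'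
  rw [key]
  constructor
  · rintro rfl; rfl
  · intro h
    have := mul_right_cancel₀ (mul_ne_zero hz0 hw0) h
    exact_mod_cast mul_left_cancel₀ two_ne_zero this

/-- Three distinct points of the unit circle, pairwise conjugate with respect to the conic
`(1 - g) x² + (1 + g) y² = C`, are the roots of `z³ + g λ z² - g z - λ`, where `λ` is their product;
moreover the conic is apolar to the circle, which determines `C`. -/
theorem symmetric_functions_of_selfPolar {z : Fin 3 → ℂ} (hz : ∀ i, ‖z i‖ = 1)
    (h01 : z 0 ≠ z 1) (h12 : z 1 ≠ z 2) (h20 : z 2 ≠ z 0) {g C : ℝ}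
    (e01 : z 0 ^ 2 + z 1 ^ 2 - g * (z 0 ^ 2 * z 1 ^ 2 + 1) = 2 * C * (z 0 * z 1))
    (e12 : z 1 ^ 2 + z 2 ^ 2 - g * (z 1 ^ 2 * z 2 ^ 2 + 1) = 2 * C * (z 1 * z 2))
    (e20 : z 2 ^ 2 + z 0 ^ 2 - g * (z 2 ^ 2 * z 0 ^ 2 + 1) = 2 * C * (z 2 * z 0)) :
    z 0 + z 1 + z 2 = -g * (z 0 * z 1 * z 2) ∧
      z 0 * z 1 + z 1 * z 2 + z 2 * z 0 = -g ∧ 2 * C = g ^ 2 - 1 := by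
  have c0 := mul_conj_of_norm_one (hz 0)
  have c1 := mul_conj_of_norm_one (hz 1)
  have c2 := mul_conj_of_norm_one (hz 2)
  have n : z 0 * z 1 * z 2 ≠ 0 := by
    rw [← norm_ne_zero_iff]
    simp [hz]
  generalize z 0 = x at *
  generalize z 1 = y at *
  generalize z 2 = w at *
  -- Two of the relations share a vertex; their difference is divisible by the opposite side.
  have f0 : (y + w) * (1 - g * x ^ 2) = 2 * C * x :=
    mul_left_cancel₀ (sub_ne_zero.2 h12) (by linear_combination e01 - e20)
  have f1 : (w + x) * (1 - g * y ^ 2) = 2 * C * y :=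
    mul_left_cancel₀ (sub_ne_zero.2 h20) (by linear_combination e12 - e01)
  have f : 1 + 2 * C = -g * (x * y + y * w + w * x) :=
    mul_left_cancel₀ (sub_ne_zero.2 h01) (by linear_combination f1 - f0)
  have s1 : x + y + w = -g * (x * y * w) := by linear_combination f0 + x * f
  -- On the unit circle the second symmetric function is the conjugate of the first, times `x y w`.
  have s2 : x * y + y * w + w * x = -g := by
    have h := congrArg conj s1
    simp only [map_add, map_mul, map_neg, conj_ofReal] at h
    have e : x * y + y * w + w * x = x * y * w * (conj x + conj y + conj w) := by
      linear_combination -(y * w) * c0 - x * w * c1 - x * y * c2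
    rw [e, h]
    linear_combination -g * (y * conj y * w * conj w) * c0 - g * (w * conj w) * c1 - g * c2
  refine ⟨s1, s2, ?_⟩
  have : (2 * C : ℂ) = g ^ 2 - 1 := by linear_combination f - g * s2
  exact_mod_cast this

/-- A root of `z³ + g λ z² - g z - λ` with `|λ| = 1` and `|g| < 1` lies on the unit circle: the
equation says that the Blaschke product `z (z² - g) / (1 - g z²)` takes the value `λ`. -/
theorem norm_eq_one_of_cubic {g : ℝ} (hg : |g| < 1) {l z : ℂ} (hl : ‖l‖ = 1)
    (h : z ^ 3 + g * l * z ^ 2 - g * z - l = 0) : ‖z‖ = 1 := by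
  have h1 : z * (z ^ 2 - g) = l * (1 - g * z ^ 2) := by linear_combination h
  have h2 : ‖z‖ ^ 2 * normSq (z ^ 2 - g) = normSq (1 - g * z ^ 2) := by
    have := congrArg normSq h1
    rw [normSq_mul, normSq_mul, ← Complex.sq_norm l, hl, ← Complex.sq_norm z] at this
    linarith
  have h3 : normSq (1 - g * z ^ 2) - normSq (z ^ 2 - g) = (1 - g ^ 2) * (1 - (‖z‖ ^ 2) ^ 2) := by
    rw [← pow_mul, mul_comm 2 2, pow_mul, ← norm_pow, Complex.sq_norm]
    generalize z ^ 2 = w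
    simp [normSq_apply]; ring
  have h4 : 0 < 1 - g ^ 2 := by
    have := (sq_lt_one_iff_abs_lt_one g).2 hg
    linarith
  have h5 := normSq_nonneg (z ^ 2 - g)
  have h6 : (1 - ‖z‖ ^ 2) * (normSq (z ^ 2 - g) + (1 - g ^ 2) * (1 + ‖z‖ ^ 2)) = 0 := by
    linear_combination -h3 - h2
  have h7 : 0 < normSq (z ^ 2 - g) + (1 - g ^ 2) * (1 + ‖z‖ ^ 2) := by positivity
  have h8 : 1 - ‖z‖ ^ 2 = 0 := (mul_eq_zero.1 h6).resolve_right h7.ne'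
  nlinarith [norm_nonneg z]

/-- Three complex numbers with prescribed elementary symmetric functions. -/
theorem exists_roots_of_cubic (A B D : ℂ) : ∃ z : Fin 3 → ℂ,
    z 0 + z 1 + z 2 = A ∧ z 0 * z 1 + z 1 * z 2 + z 2 * z 0 = B ∧ z 0 * z 1 * z 2 = D := by
  obtain ⟨x, hx⟩ := IsAlgClosed.exists_root
    (Polynomial.X ^ 3 - Polynomial.C A * Polynomial.X ^ 2 + Polynomial.C B * Polynomial.X
      - Polynomial.C D) (by
        have : (Polynomial.X ^ 3 - Polynomial.C A * Polynomial.X ^ 2 +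
          Polynomial.C B * Polynomial.X - Polynomial.C D).degree = 3 := by compute_degree!
        rw [this]; decide)
  obtain ⟨s, hs⟩ := IsAlgClosed.exists_eq_mul_self (discrim 1 (x - A) (B - x * (A - x)))
  obtain ⟨y, hy⟩ := exists_quadratic_eq_zero (one_ne_zero) ⟨s, hs⟩
  simp only [Polynomial.IsRoot, Polynomial.eval_sub, Polynomial.eval_add, Polynomial.eval_pow,
    Polynomial.eval_mul, Polynomial.eval_X, Polynomial.eval_C] at hx
  refine ⟨![x, y, A - x - y], ?_, ?_, ?_⟩
  · simp
  · simp; linear_combination -hy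
  · simp; linear_combination hx - x * hy

/-- A double root `x` would give `2 x = -w (1 + g x²)`, whose right side is shorter than `2`. -/
lemma ne_of_cubic {g : ℝ} (hg : |g| < 1) {x y w : ℂ} (hx : ‖x‖ = 1) (hw : ‖w‖ = 1)
    (h : x + y + w = -g * (x * y * w)) : x ≠ y := by
  rintro rfl
  have h1 : 2 * x = -(w * (1 + g * x ^ 2)) := by linear_combination h
  have h2 := congrArg norm h1
  rw [norm_mul, norm_neg, norm_mul, hx, hw] at h2
  have h3 := norm_add_le 1 (g * x ^ 2)
  rw [norm_mul, norm_pow, hx, norm_real, Real.norm_eq_abs] at h3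
  norm_num at h2 h3
  linarith

lemma polar_of_cubic {g : ℝ} {x y w : ℂ} (h1 : x + y + w = -g * (x * y * w))
    (h2 : x * y + y * w + w * x = -g) :
    x ^ 2 + y ^ 2 - g * (x ^ 2 * y ^ 2 + 1) = (g ^ 2 - 1) * (x * y) := by
  linear_combination (x + y) * h1 - (1 + g * (x * y)) * h2

/-- Every `λ` on the unit circle is the product of three distinct points of the unit circle which
are pairwise conjugate with respect to `(1 - g) x² + (1 + g) y² = (g² - 1) / 2`. -/
theorem exists_selfPolar {g : ℝ} (hg : |g| < 1) {l : ℂ} (hl : ‖l‖ = 1) :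
    ∃ z : Fin 3 → ℂ, (∀ i, ‖z i‖ = 1) ∧ Function.Injective z ∧
      z 0 + z 1 + z 2 = -g * (z 0 * z 1 * z 2) ∧
      z 0 * z 1 + z 1 * z 2 + z 2 * z 0 = -g ∧ z 0 * z 1 * z 2 = l := by
  obtain ⟨z, h1, h2, h3⟩ := exists_roots_of_cubic (-g * l) (-g) l
  have hz : ∀ i, ‖z i‖ = 1 := by
    intro i
    refine norm_eq_one_of_cubic hg hl (z := z i) ?_
    have : z i ^ 3 - (z 0 + z 1 + z 2) * z i ^ 2 + (z 0 * z 1 + z 1 * z 2 + z 2 * z 0) * z i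
      - z 0 * z 1 * z 2 = 0 := by fin_cases i <;> simp <;> ring
    rw [h1, h2, h3] at this
    linear_combination this
  rw [← h3] at h1
  have a01 := ne_of_cubic hg (hz 0) (hz 2) h1
  have a12 : z 1 ≠ z 2 := ne_of_cubic hg (hz 1) (hz 0) (by linear_combination h1)
  have a02 : z 0 ≠ z 2 := ne_of_cubic hg (hz 0) (hz 1) (by linear_combination h1)
  refine ⟨z, hz, ?_, h1, h2, h3⟩
  intro i j hij
  fin_cases i <;> fin_cases j <;> simp_all

/-- The real part of the cubic equation divided by `z`, which uses `z⁻¹ = conj z`. It says that,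
after `x + i y ↦ (a x, b y)`, the roots of the cubic are equidistant from a point that is linear in
`λ`: see `circumcenter_eq`. -/
lemma re_eq_of_cubic {g : ℝ} {l z : ℂ} (hz : ‖z‖ = 1)
    (h : z ^ 3 + g * l * z ^ 2 - g * z - l = 0) :
    2 * z.re ^ 2 - ((1 - g) * l.re * z.re + (1 + g) * l.im * z.im) = 1 + g := by
  have c := mul_conj_of_norm_one hz
  have h1 : z ^ 2 + g * l * z - g - l * conj z = 0 := by
    linear_combination conj z * h - (z ^ 2 + g * l * z - g) * c
  have h2 := congrArg re h1
  have := re_sq_add_im_sq_of_norm_one hz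
  simp [pow_two] at h2
  linear_combination h2 + this

/-! ### The ellipse, its tangents, and the law of reflection -/

/-- The real linear map `x + i y ↦ a x e₀ + b y e₁`. -/
noncomputable def ellipseMap (e : OrthonormalBasis (Fin 2) ℝ Plane) (a b : ℝ) : ℂ →ₗ[ℝ] Plane where
  toFun z := (a * z.re) • e 0 + (b * z.im) • e 1
  map_add' z w := by simp only [add_re, add_im]; module
  map_smul' t z := by simp only [real_smul, re_ofReal_mul, im_ofReal_mul, RingHom.id_apply]; module

/-- The ellipse with center `c`, frame `e` and semi-axes `|a|, |b|`, as an affine image of the unit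
circle of `ℂ`. -/
def ellipse (c : Plane) (e : OrthonormalBasis (Fin 2) ℝ Plane) (a b : ℝ) : Set Plane :=
  {p | ∃ z : ℂ, ‖z‖ = 1 ∧ c + ellipseMap e a b z = p}

section

variable (c : Plane) (e : OrthonormalBasis (Fin 2) ℝ Plane) (a b : ℝ)

lemma ellipseMap_apply (z : ℂ) : ellipseMap e a b z = (a * z.re) • e 0 + (b * z.im) • e 1 := rfl

lemma inner_ellipseMap (a' b' : ℝ) (z w : ℂ) :
    ⟪ellipseMap e a b z, ellipseMap e a' b' w⟫ =
      a * a' * (z.re * w.re) + b * b' * (z.im * w.im) := by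
  simp [ellipseMap_apply, inner_add_left, inner_add_right, inner_smul_left, inner_smul_right,
    e.inner_eq_ite]
  ring

lemma norm_sq_ellipseMap (z : ℂ) :
    ‖ellipseMap e a b z‖ ^ 2 = a ^ 2 * z.re ^ 2 + b ^ 2 * z.im ^ 2 := by
  rw [← real_inner_self_eq_norm_sq, inner_ellipseMap]
  ring

lemma repr_ellipseMap_zero (z : ℂ) : e.repr (ellipseMap e a b z) 0 = a * z.re := by
  simp [ellipseMap_apply]

lemma repr_ellipseMap_one (z : ℂ) : e.repr (ellipseMap e a b z) 1 = b * z.im := by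
  simp [ellipseMap_apply]

variable {a b}

lemma injective_ellipseMap (ha : a ≠ 0) (hb : b ≠ 0) : Function.Injective (ellipseMap e a b) := by
  intro z w h
  have h0 := repr_ellipseMap_zero e a b z
  have h1 := repr_ellipseMap_one e a b z
  rw [h, repr_ellipseMap_zero] at h0
  rw [h, repr_ellipseMap_one] at h1
  exact Complex.ext (mul_left_cancel₀ ha h0.symm) (mul_left_cancel₀ hb h1.symm)

lemma exists_ellipseMap_eq (ha : a ≠ 0) (hb : b ≠ 0) (v : Plane) : ∃ z, ellipseMap e a b z = v := by
  refine ⟨⟨e.repr v 0 / a, e.repr v 1 / b⟩, ?_⟩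
  rw [ellipseMap_apply]
  simp only
  rw [mul_div_cancel₀ _ ha, mul_div_cancel₀ _ hb]
  conv_rhs => rw [← e.sum_repr v]
  simp

lemma ellipse_eq_setOf (ha : a ≠ 0) (hb : b ≠ 0) : ellipse c e a b =
    {p | (e.repr (p - c) 0 / a) ^ 2 + (e.repr (p - c) 1 / b) ^ 2 = 1} := by
  have key (z : ℂ) : (e.repr (c + ellipseMap e a b z - c) 0 / a) ^ 2 +
      (e.repr (c + ellipseMap e a b z - c) 1 / b) ^ 2 = z.re ^ 2 + z.im ^ 2 := by
    rw [add_sub_cancel_left, repr_ellipseMap_zero, repr_ellipseMap_one,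
      mul_div_cancel_left₀ _ ha, mul_div_cancel_left₀ _ hb]
  ext p
  constructor
  · rintro ⟨z, hz, rfl⟩
    exact (key z).trans (re_sq_add_im_sq_of_norm_one hz)
  · intro hp
    obtain ⟨z, hz⟩ := exists_ellipseMap_eq e ha hb (p - c)
    obtain rfl : c + ellipseMap e a b z = p := by rw [hz]; abel
    exact ⟨z, norm_one_of_re_sq_add_im_sq ((key z).symm.trans hp), rfl⟩

lemma isEllipse_ellipse (ha : a ≠ 0) (hb : b ≠ 0) : IsEllipse (ellipse c e a b) := by
  refine ⟨c, e, |a|, |b|, abs_pos.2 ha, abs_pos.2 hb, ?_⟩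
  rw [ellipse_eq_setOf c e ha hb]
  simp only [div_pow, sq_abs]

/-- The tangent line at a point of the ellipse is orthogonal to the gradient of the equation of the
ellipse. -/
theorem tangentDirection_ellipse (ha : a ≠ 0) (hb : b ≠ 0) {z : ℂ} (hz : ‖z‖ = 1) :
    tangentDirection (ellipse c e a b) (c + ellipseMap e a b z) =
      (ℝ ∙ ellipseMap e a⁻¹ b⁻¹ z)ᗮ := by
  set n := ellipseMap e a⁻¹ b⁻¹ z with hn
  have hn0 : n ≠ 0 := by
    rw [hn, map_ne_zero_iff _ (injective_ellipseMap e (inv_ne_zero ha) (inv_ne_zero hb))]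
    rintro rfl
    simp at hz
  have hle : tangentDirection (ellipse c e a b) (c + ellipseMap e a b z) ≤ (ℝ ∙ n)ᗮ := by
    rw [tangentDirection, Submodule.span_le]
    intro v hv
    -- The function `f` is constant on the ellipse, so its derivative vanishes on tangent vectors.
    let f : Plane → ℝ := fun p => (⟪e 0, p - c⟫ / a) ^ 2 + (⟪e 1, p - c⟫ / b) ^ 2
    have hd (i : Fin 2) (q : Plane) : HasFDerivAt (fun p => ⟪e i, p - c⟫) (innerSL ℝ (e i)) q :=
      (innerSL ℝ (e i)).hasFDerivAt.comp q ((hasFDerivAt_id q).sub_const c)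
    have hf := (((hd 0 (c + ellipseMap e a b z)).mul_const a⁻¹).pow 2).add
      (((hd 1 (c + ellipseMap e a b z)).mul_const b⁻¹).pow 2)
    have himg : (fun p => (⟪e 0, p - c⟫ * a⁻¹) ^ 2 + (⟪e 1, p - c⟫ * b⁻¹) ^ 2) ''
        ellipse c e a b ⊆ {1} := by
      rw [ellipse_eq_setOf c e ha hb]
      rintro _ ⟨p, hp, rfl⟩
      simpa only [Set.mem_ofPred_eq, Set.mem_singleton_iff, e.repr_apply_apply,
        div_eq_mul_inv] using hp
    have h0 := tangentConeAt_subset_zero (fun h => ?_)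
      (tangentConeAt_mono himg (hf.hasFDerivWithinAt.mapsTo_tangent_cone hv))
    · simp only [add_sub_cancel_left, ← e.repr_apply_apply, repr_ellipseMap_zero,
        repr_ellipseMap_one] at h0
      rw [SetLike.mem_coe, Submodule.mem_orthogonal_singleton_iff_inner_right, hn, ellipseMap_apply]
      simp [inner_add_left, inner_smul_left] at h0 ⊢
      field_simp at h0 ⊢
      linear_combination h0 / 2
    · exact Set.Infinite.of_accPt h (Set.finite_singleton _)
  -- The velocity of `t ↦ exp (i t) z` at `0`, mapped to the plane, is a nonzero tangent vector.
  have hmem : ellipseMap e a b (I * z) ∈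
      tangentDirection (ellipse c e a b) (c + ellipseMap e a b z) := by
    apply Submodule.subset_span
    have h1 : HasDerivAt (fun t : ℝ => c + ellipseMap e a b (exp (t * I) * z))
        (ellipseMap e a b (I * z)) 0 := by
      have hexp : HasDerivAt (fun t : ℝ => exp (t * I) * z) (I * z) 0 := by
        have := (((hasDerivAt_id (0 : ℝ)).ofReal_comp.mul_const I).cexp).mul_const z
        simpa using this
      exact ((ellipseMap e a b).toContinuousLinearMap.hasFDerivAt.comp_hasDerivAt 0
        hexp).const_add c
    have h2 := (h1.hasFDerivAt.hasFDerivWithinAt (s := Set.univ)).mapsTo_tangent_cone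
      (show (1 : ℝ) ∈ tangentConeAt ℝ Set.univ 0 by rw [tangentConeAt_univ]; trivial)
    have h3 := tangentConeAt_mono (t := ellipse c e a b) (by
      rintro _ ⟨t, -, rfl⟩
      exact ⟨_, by rw [norm_mul, norm_exp_ofReal_mul_I, hz, one_mul], rfl⟩) h2
    simpa using h3
  have hpos : 0 < finrank ℝ (tangentDirection (ellipse c e a b) (c + ellipseMap e a b z)) := by
    refine finrank_pos_iff_exists_ne_zero.2 ⟨⟨_, hmem⟩, ?_⟩
    rw [Ne, Submodule.mk_eq_zero, map_eq_zero_iff _ (injective_ellipseMap e ha hb)]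
    rw [← norm_eq_zero, norm_mul, hz]
    simp
  have : Fact (finrank ℝ Plane = 1 + 1) := ⟨by simp⟩
  refine Submodule.eq_of_le_of_finrank_le hle ?_
  rw [Submodule.finrank_orthogonal_span_singleton (n := 1) hn0]
  exact hpos

end

lemma inner_reflection_orthogonal_singleton (n u : Plane) :
    ⟪n, (ℝ ∙ n)ᗮ.reflection u⟫ = -⟪n, u⟫ := by
  have h := (ℝ ∙ n)ᗮ.reflection.inner_map_map n u
  rw [Submodule.reflection_orthogonalComplement_singleton_eq_neg, inner_neg_left] at h
  linarith

/-- Two vectors of the plane with the same norm and the same component along `n ≠ 0` are equal or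
mirror images of each other in the line spanned by `n`; in the second case the reflection in the
orthogonal line takes one to the opposite of the other. -/
lemma eq_or_reflection_eq {n v w : Plane} (hn : n ≠ 0) (h1 : ‖v‖ = ‖w‖) (h2 : ⟪n, v⟫ = ⟪n, w⟫) :
    v = w ∨ (ℝ ∙ n)ᗮ.reflection v = -w := by
  by_cases h : v = w
  · exact Or.inl h
  right
  have hx : v - w ≠ 0 := sub_ne_zero.2 h
  have : Fact (finrank ℝ Plane = 1 + 1) := ⟨by simp⟩
  have e1 : n ∈ (ℝ ∙ (v - w))ᗮ := by
    rw [Submodule.mem_orthogonal_singleton_iff_inner_left, inner_sub_right, h2, sub_self]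
  have e2 : v + w ∈ (ℝ ∙ (v - w))ᗮ := by
    rw [Submodule.mem_orthogonal_singleton_iff_inner_left]
    exact (real_inner_add_sub_eq_zero_iff v w).2 h1
  -- In the plane the orthogonal complement of `v - w` is the line spanned by `n`.
  have e3 : (ℝ ∙ n) = (ℝ ∙ (v - w))ᗮ := by
    refine Submodule.eq_of_le_of_finrank_le (by simpa using e1) ?_
    rw [Submodule.finrank_orthogonal_span_singleton (n := 1) hx, finrank_span_singleton hn]
  have e4 : (ℝ ∙ n)ᗮ.reflection (v - w) = v - w := by
    rw [Submodule.reflection_eq_self_iff, e3, Submodule.orthogonal_orthogonal]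
    exact Submodule.mem_span_singleton_self _
  have e5 : (ℝ ∙ n)ᗮ.reflection (v + w) = -(v + w) := by
    apply Submodule.reflection_mem_subspace_orthogonal_precomplement_eq_neg
    rwa [e3]
  have e6 : (2 : ℝ) • (ℝ ∙ n)ᗮ.reflection v = (2 : ℝ) • (-w) := by
    rw [← map_smul, show (2 : ℝ) • v = (v - w) + (v + w) by module, map_add, e4, e5]
    module
  exact smul_right_injective _ two_ne_zero e6

/-- The law of reflection implies that the two sides at `q` make the same angle with the normal
`n`. -/
lemma ReflectsAt.norm_mul_inner {S : Set Plane} {p q r n : Plane}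
    (hS : tangentDirection S q = (ℝ ∙ n)ᗮ) (h : ReflectsAt S p q r) :
    ‖p - q‖ * ⟪n, r - q⟫ = ‖r - q‖ * ⟪n, p - q⟫ := by
  rw [ReflectsAt, sameRay_iff_norm_smul_eq, LinearIsometryEquiv.norm_map] at h
  have := congrArg (fun x => ⟪n, x⟫) h
  simp only [hS, inner_smul_right, inner_reflection_orthogonal_singleton] at this
  rw [norm_sub_rev p q, this, ← inner_neg_right, neg_sub]

/-- If the two sides at `q` make the same angle with the normal, the law of reflection holds, unless
both sides lie on the same ray, which affine independence excludes. -/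
lemma reflectsAt_of_norm_mul_inner {S : Set Plane} {p q r n : Plane} (hn : n ≠ 0)
    (hS : tangentDirection S q = (ℝ ∙ n)ᗮ) (hne : AffineIndependent ℝ ![p, q, r])
    (h : ‖p - q‖ * ⟪n, r - q⟫ = ‖r - q‖ * ⟪n, p - q⟫) : ReflectsAt S p q r := by
  rw [ReflectsAt, sameRay_iff_norm_smul_eq, LinearIsometryEquiv.norm_map]
  simp only [hS]
  have hqr : ‖r - q‖ ≠ 0 := by
    rw [norm_ne_zero_iff, sub_ne_zero]
    exact fun h => absurd (hne.injective (a₁ := 2) (a₂ := 1) h) (by decide)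
  have h1 : ‖‖r - q‖ • (ℝ ∙ n)ᗮ.reflection (q - p)‖ = ‖‖q - p‖ • (r - q)‖ := by
    rw [norm_smul, norm_smul, LinearIsometryEquiv.norm_map, norm_norm, norm_norm, mul_comm]
  have h2 : ⟪n, ‖r - q‖ • (ℝ ∙ n)ᗮ.reflection (q - p)⟫ = ⟪n, ‖q - p‖ • (r - q)⟫ := by
    rw [inner_smul_right, inner_smul_right, inner_reflection_orthogonal_singleton,
      ← inner_neg_right, neg_sub, ← h, norm_sub_rev]
  rcases eq_or_reflection_eq hn h1 h2 with h' | h'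
  · exact h'.symm
  · exfalso
    rw [map_smul, Submodule.reflection_reflection] at h'
    refine affineIndependent_iff_not_collinear_set.1 hne
      ((collinear_iff_of_mem (p₀ := q) (by simp)).2 ⟨r - q, ?_⟩)
    have hp : p = (‖q - p‖ / ‖r - q‖) • (r - q) +ᵥ q := by
      have : p - q = ‖r - q‖⁻¹ • (‖q - p‖ • (r - q)) := by
        rw [← neg_eq_iff_eq_neg.2 h', ← smul_neg, smul_smul, inv_mul_cancel₀ hqr]
        simp
      rw [div_eq_inv_mul, mul_smul, ← this]
      simp
    rintro x (rfl | rfl | rfl)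
    · exact ⟨_, hp⟩
    · exact ⟨0, by simp⟩
    · exact ⟨1, by simp⟩

/-! ### Triangular orbits and their circumcenters -/

lemma one_sub_inner_pos {z w : ℂ} (hz : ‖z‖ = 1) (hw : ‖w‖ = 1) (h : z ≠ w) :
    0 < 1 - z.re * w.re - z.im * w.im := by
  have h1 := re_sq_add_im_sq_of_norm_one hz
  have h2 := re_sq_add_im_sq_of_norm_one hw
  have h3 : 0 < normSq (z - w) := normSq_pos.2 (sub_ne_zero.2 h)
  rw [normSq_apply, sub_re, sub_im] at h3
  linarith

section

variable (e : OrthonormalBasis (Fin 2) ℝ Plane) {a b : ℝ}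

/-- The squared length of a chord of the ellipse is divisible by the bilinear form of
`inner_normal_chord`. -/
lemma norm_sq_ellipseMap_sub {z w : ℂ} (hz : ‖z‖ = 1) (hw : ‖w‖ = 1) :
    ‖ellipseMap e a b z - ellipseMap e a b w‖ ^ 2 = (1 - z.re * w.re - z.im * w.im) *
      (a ^ 2 + b ^ 2 - (a ^ 2 - b ^ 2) * (z.re * w.re - z.im * w.im)) := by
  rw [← map_sub, norm_sq_ellipseMap, sub_re, sub_im]
  have h1 := re_sq_add_im_sq_of_norm_one hz
  have h2 := re_sq_add_im_sq_of_norm_one hw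
  linear_combination a ^ 2 * (z.im ^ 2 * h2 + (1 - w.re ^ 2) * h1) +
    b ^ 2 * (z.re ^ 2 * h2 + (1 - w.im ^ 2) * h1)

/-- Joachimsthal's bilinear form: the product of the normal at one end of a chord with the chord is
symmetric in the two ends. -/
lemma inner_normal_chord (ha : a ≠ 0) (hb : b ≠ 0) {z : ℂ} (hz : ‖z‖ = 1) (w : ℂ) :
    ⟪ellipseMap e a⁻¹ b⁻¹ z, ellipseMap e a b w - ellipseMap e a b z⟫ =
      -(1 - z.re * w.re - z.im * w.im) := by
  rw [← map_sub, inner_ellipseMap, inv_mul_cancel₀ ha, inv_mul_cancel₀ hb, sub_re, sub_im]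
  linear_combination -re_sq_add_im_sq_of_norm_one hz

end

lemma affineSpan_range_points_eq_top (T : Affine.Simplex ℝ Plane 2) :
    affineSpan ℝ (Set.range T.points) = ⊤ :=
  T.independent.affineSpan_eq_top_iff_card_eq_finrank_add_one.2 (by simp)

lemma isPeriodicOrbit_three_iff {S : Set Plane} {p : Fin 3 → Plane} : IsPeriodicOrbit S 3 p ↔
    (∀ i, p i ∈ S) ∧ (p 0 ≠ p 1 ∧ p 1 ≠ p 2 ∧ p 2 ≠ p 0) ∧
      ReflectsAt S (p 0) (p 1) (p 2) ∧ ReflectsAt S (p 1) (p 2) (p 0) ∧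
      ReflectsAt S (p 2) (p 0) (p 1) := by
  simp [IsPeriodicOrbit, Fin.forall_fin_succ]

section

variable {c : Plane} {e : OrthonormalBasis (Fin 2) ℝ Plane} {a b : ℝ}

/-- For a side of an orbit, the product of its unit direction with the normal at either end is the
same up to sign at both ends (`inner_normal_chord`) and is preserved by reflection, so it is the same
for the three sides: this is Joachimsthal's integral, and `k` is its square. By
`norm_sq_ellipseMap_sub` the resulting relation has degree one in each of two vertices. -/
theorem joachimsthal_of_orbit (ha : a ≠ 0) (hb : b ≠ 0) {z : Fin 3 → ℂ} (hz : ∀ i, ‖z i‖ = 1)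
    (h : IsPeriodicOrbit (ellipse c e a b) 3 (fun i => c + ellipseMap e a b (z i))) :
    z 0 ≠ z 1 ∧ z 1 ≠ z 2 ∧ z 2 ≠ z 0 ∧ ∃ k : ℝ, 0 < k ∧ ∀ i j, z i ≠ z j →
      1 - (z i).re * (z j).re - (z i).im * (z j).im =
        k * (a ^ 2 + b ^ 2 - (a ^ 2 - b ^ 2) * ((z i).re * (z j).re - (z i).im * (z j).im)) := by
  obtain ⟨-, ⟨h01, h12, h20⟩, r1, r2, r0⟩ := isPeriodicOrbit_three_iff.1 h
  have n01 : z 0 ≠ z 1 := fun h => h01 (by simp only [h])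
  have n12 : z 1 ≠ z 2 := fun h => h12 (by simp only [h])
  have n20 : z 2 ≠ z 0 := fun h => h20 (by simp only [h])
  refine ⟨n01, n12, n20, ?_⟩
  have t (i : Fin 3) := tangentDirection_ellipse c e ha hb (hz i)
  let N (i j : Fin 3) : ℝ := 1 - (z i).re * (z j).re - (z i).im * (z j).im
  let L (i j : Fin 3) : ℝ := ‖ellipseMap e a b (z i) - ellipseMap e a b (z j)‖
  have hN (i j : Fin 3) (h : z i ≠ z j) : 0 < N i j := one_sub_inner_pos (hz i) (hz j) h
  have hL (i j : Fin 3) (h : z i ≠ z j) : 0 < L i j :=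
    norm_pos_iff.2 (sub_ne_zero.2 ((injective_ellipseMap e ha hb).ne h))
  have sN (i j : Fin 3) : N i j = N j i := by simp only [N]; ring
  have sL (i j : Fin 3) : L i j = L j i := norm_sub_rev _ _
  have law (i j l : Fin 3) (h : ReflectsAt (ellipse c e a b) (c + ellipseMap e a b (z i))
      (c + ellipseMap e a b (z j)) (c + ellipseMap e a b (z l))) :
      L i j * N j l = L j l * N i j := by
    have := h.norm_mul_inner (t j)
    rw [add_sub_add_left_eq_sub, add_sub_add_left_eq_sub, inner_normal_chord e ha hb (hz j),
      inner_normal_chord e ha hb (hz j)] at this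
    rw [sN i j, sL j l]
    linarith
  have l1 := law 0 1 2 r1
  have l0 := law 2 0 1 r0
  refine ⟨(N 0 1 / L 0 1) ^ 2, by have := hN 0 1 n01; have := hL 0 1 n01; positivity, ?_⟩
  -- Squaring `N = J L` and cancelling one factor `N` leaves a relation of degree one in each point.
  have key (i j : Fin 3) (h : z i ≠ z j) (hj : L 0 1 * N i j = L i j * N 0 1) : N i j =
      (N 0 1 / L 0 1) ^ 2 * (a ^ 2 + b ^ 2 -
        (a ^ 2 - b ^ 2) * ((z i).re * (z j).re - (z i).im * (z j).im)) := by
    have e1 : N i j = L i j * (N 0 1 / L 0 1) := by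
      field_simp [(hL 0 1 n01).ne']
      linarith
    have e2 : L i j ^ 2 = N i j * _ := norm_sq_ellipseMap_sub e (hz i) (hz j)
    refine mul_left_cancel₀ (hN i j h).ne' ?_
    rw [mul_left_comm, ← e2]
    calc N i j * N i j = (L i j * (N 0 1 / L 0 1)) * (L i j * (N 0 1 / L 0 1)) := by rw [← e1]
      _ = _ := by ring
  have key' (i j : Fin 3) (h : z i ≠ z j) : L 0 1 * N i j = L i j * N 0 1 := by
    fin_cases i <;> fin_cases j <;> simp at h ⊢
    · rw [sN 0 2, sL 0 2]; linarith
    · rw [sN 1 0, sL 1 0]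
    · linarith
    · linarith
    · rw [sN 2 1, sL 2 1]; linarith
  exact fun i j h => key i j h (key' i j h)

theorem affineIndependent_ellipse (ha : a ≠ 0) (hb : b ≠ 0) {z : Fin 3 → ℂ} (hz : ∀ i, ‖z i‖ = 1)
    (hinj : Function.Injective z) : AffineIndependent ℝ (fun i => c + ellipseMap e a b (z i)) := by
  have h : AffineIndependent ℝ z :=
    EuclideanGeometry.Cospherical.affineIndependent (s := Metric.sphere (0 : ℂ) 1)
      ⟨0, 1, fun _ h => h⟩ (by rintro _ ⟨i, rfl⟩; simpa using hz i) hinj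
  exact h.map' (AffineMap.const ℝ ℂ c + (ellipseMap e a b).toAffineMap)
    fun x y hxy => injective_ellipseMap e ha hb (add_left_cancel hxy)

/-- The converse of `joachimsthal_of_orbit`. -/
theorem orbit_of_joachimsthal (ha : a ≠ 0) (hb : b ≠ 0) {z : Fin 3 → ℂ} (hz : ∀ i, ‖z i‖ = 1)
    (hinj : Function.Injective z) {k : ℝ} (hk : 0 < k)
    (h : ∀ i j, z i ≠ z j → 1 - (z i).re * (z j).re - (z i).im * (z j).im =
        k * (a ^ 2 + b ^ 2 - (a ^ 2 - b ^ 2) * ((z i).re * (z j).re - (z i).im * (z j).im))) :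
    IsPeriodicOrbit (ellipse c e a b) 3 (fun i => c + ellipseMap e a b (z i)) := by
  have hai : AffineIndependent ℝ (fun i => c + ellipseMap e a b (z i)) :=
    affineIndependent_ellipse ha hb hz hinj
  have hchord (i j : Fin 3) (hij : i ≠ j) : 1 - (z i).re * (z j).re - (z i).im * (z j).im =
      √k * ‖ellipseMap e a b (z i) - ellipseMap e a b (z j)‖ := by
    have hN := one_sub_inner_pos (hz i) (hz j) (hinj.ne hij)
    refine (sq_eq_sq₀ hN.le (by positivity)).1 ?_
    rw [mul_pow, Real.sq_sqrt hk.le, norm_sq_ellipseMap_sub e (hz i) (hz j), mul_left_comm,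
      ← h i j (hinj.ne hij), sq]
  have law (i j l : Fin 3) (hij : i ≠ j) (hjl : j ≠ l) (hil : i ≠ l) :
      ReflectsAt (ellipse c e a b) (c + ellipseMap e a b (z i))
        (c + ellipseMap e a b (z j)) (c + ellipseMap e a b (z l)) := by
    refine reflectsAt_of_norm_mul_inner ?_ (tangentDirection_ellipse c e ha hb (hz j)) ?_ ?_
    · rw [map_ne_zero_iff _ (injective_ellipseMap e (inv_ne_zero ha) (inv_ne_zero hb))]
      intro h0
      simpa [h0] using hz j
    · have := affineIndependent_ellipse (c := c) (e := e) ha hb (z := ![z i, z j, z l])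
        (by simp [Fin.forall_fin_succ, hz]) (by
          intro x y hxy
          fin_cases x <;> fin_cases y <;> simp [hinj.eq_iff] at hxy ⊢ <;> simp_all)
      convert this using 1
      ext x
      fin_cases x <;> rfl
    · rw [add_sub_add_left_eq_sub, add_sub_add_left_eq_sub, inner_normal_chord e ha hb (hz j),
        inner_normal_chord e ha hb (hz j), hchord j l hjl, hchord j i hij.symm,
        norm_sub_rev (ellipseMap e a b (z j)), norm_sub_rev (ellipseMap e a b (z j))]
      ring
  refine isPeriodicOrbit_three_iff.2 ⟨fun i => ⟨z i, hz i, rfl⟩,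
    ⟨hai.injective.ne (by decide), hai.injective.ne (by decide), hai.injective.ne (by decide)⟩,
    law 0 1 2 (by decide) (by decide) (by decide), law 1 2 0 (by decide) (by decide) (by decide),
    law 2 0 1 (by decide) (by decide) (by decide)⟩

/-- The circumcenter of the triangle whose vertices come from the roots of
`z³ + g λ z² - g z - λ` is a linear function of `λ`, the product of the roots. -/
theorem circumcenter_eq (ha : a ≠ 0) (hb : b ≠ 0) {g : ℝ} {z : Fin 3 → ℂ} (hz : ∀ i, ‖z i‖ = 1)
    (h1 : z 0 + z 1 + z 2 = -g * (z 0 * z 1 * z 2))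
    (h2 : z 0 * z 1 + z 1 * z 2 + z 2 * z 0 = -g)
    (T : Affine.Simplex ℝ Plane 2) (hT : ∀ i, T.points i = c + ellipseMap e a b (z i)) :
    T.circumcenter = c + ellipseMap e ((a ^ 2 - b ^ 2) * (1 - g) / (4 * a))
      ((a ^ 2 - b ^ 2) * (1 + g) / (4 * b)) (z 0 * z 1 * z 2) := by
  symm
  set l := z 0 * z 1 * z 2 with hl
  set O := ellipseMap e ((a ^ 2 - b ^ 2) * (1 - g) / (4 * a))
      ((a ^ 2 - b ^ 2) * (1 + g) / (4 * b)) l with hO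
  refine T.eq_circumcenter_of_dist_eq (by rw [affineSpan_range_points_eq_top]; trivial)
    (r := √(b ^ 2 + (a ^ 2 - b ^ 2) * (1 + g) / 2 + ‖O‖ ^ 2)) fun i => ?_
  have hc : z i ^ 3 + g * l * z i ^ 2 - g * z i - l = 0 := by
    have : z i ^ 3 - (z 0 + z 1 + z 2) * z i ^ 2 + (z 0 * z 1 + z 1 * z 2 + z 2 * z 0) * z i
      - z 0 * z 1 * z 2 = 0 := by fin_cases i <;> simp <;> ring
    rw [h1, h2, ← hl] at this
    linear_combination this
  have hr := re_eq_of_cubic (hz i) hc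
  have hu := re_sq_add_im_sq_of_norm_one (hz i)
  rw [hT, dist_eq_norm, add_sub_add_left_eq_sub, ← Real.sqrt_sq (norm_nonneg _),
    norm_sub_sq_real, norm_sq_ellipseMap, hO, inner_ellipseMap, ← hO]
  congr 2
  field_simp
  linear_combination 8 * b ^ 2 * hu + 4 * (a ^ 2 - b ^ 2) * hr
end

/-! ### The set of circumcenters -/

/-- The equation solved by the square `k` of Joachimsthal's integral of a triangular orbit, where
`S = a² + b²` and `d = a² - b²`. -/
lemma exists_pos_root {S d : ℝ} (hS : 0 < S) (hd : |d| < S) :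
    ∃ k : ℝ, 0 < k ∧ (k * d) ^ 2 + 2 * S * k - 3 = 0 ∧ |k * d| < 1 := by
  have h0 : 0 ≤ S ^ 2 + 3 * d ^ 2 := by positivity
  have hr := Real.sq_sqrt h0
  set r := √(S ^ 2 + 3 * d ^ 2)
  have hr0 : 0 ≤ r := Real.sqrt_nonneg _
  have hk : 0 < 3 / (S + r) := by positivity
  have he : (3 / (S + r) * d) ^ 2 + 2 * S * (3 / (S + r)) - 3 = 0 := by
    field_simp
    linear_combination -3 * hr
  refine ⟨_, hk, he, ?_⟩
  generalize 3 / (S + r) = k at hk he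
  rw [abs_mul, abs_of_pos hk]
  have h1 : k * |d| < S * k := by nlinarith
  rw [← sq_abs, abs_mul, abs_of_pos hk] at he
  by_contra! h
  nlinarith

lemma eq_of_pos_root {S d k k' : ℝ} (hS : 0 < S) (hk : 0 < k) (hk' : 0 < k')
    (h : (k * d) ^ 2 + 2 * S * k - 3 = 0) (h' : (k' * d) ^ 2 + 2 * S * k' - 3 = 0) : k = k' := by
  have h1 : (k - k') * (d ^ 2 * (k + k') + 2 * S) = 0 := by linear_combination h - h'
  have h2 : 0 < d ^ 2 * (k + k') + 2 * S := by positivity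
  exact sub_eq_zero.1 ((mul_eq_zero.1 h1).resolve_right h2.ne')

/-- The set of circumcenters is an affine image of the unit circle, for circles too: there
`a² - b² = 0` and the image is one point. -/
theorem circumcenters_ellipse (c : Plane) (e : OrthonormalBasis (Fin 2) ℝ Plane) {a b : ℝ}
    (ha : 0 < a) (hb : 0 < b) : ∃ g : ℝ, |g| < 1 ∧ circumcenters (ellipse c e a b) =
      ellipse c e ((a ^ 2 - b ^ 2) * (1 - g) / (4 * a)) ((a ^ 2 - b ^ 2) * (1 + g) / (4 * b)) := by
  have hS : 0 < a ^ 2 + b ^ 2 := by positivity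
  have hd : |a ^ 2 - b ^ 2| < a ^ 2 + b ^ 2 := by
    rw [abs_lt]
    constructor <;> nlinarith [pow_pos ha 2, pow_pos hb 2]
  obtain ⟨k, hk, hroot, hg⟩ := exists_pos_root hS hd
  refine ⟨k * (a ^ 2 - b ^ 2), hg, ?_⟩
  ext o
  constructor
  · rintro ⟨T, hT, rfl⟩
    choose z hz hzT using hT.1
    have hTz : T.points = fun i => c + ellipseMap e a b (z i) := funext fun i => (hzT i).symm
    rw [hTz] at hT
    obtain ⟨n01, n12, n20, k', hk', h⟩ := joachimsthal_of_orbit ha.ne' hb.ne' hz hT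
    have hp (i j : Fin 3) (hij : z i ≠ z j) := (polar_iff (hz i) (hz j)
      (k' * (a ^ 2 - b ^ 2)) (1 - k' * (a ^ 2 + b ^ 2))).1 (by linear_combination -(h i j hij))
    obtain ⟨h1, h2, h3⟩ := symmetric_functions_of_selfPolar hz n01 n12 n20
      (hp 0 1 n01) (hp 1 2 n12) (hp 2 0 n20)
    obtain rfl : k = k' := eq_of_pos_root hS hk hk' hroot (by linear_combination -h3)
    exact ⟨z 0 * z 1 * z 2, by simp [hz],
      (circumcenter_eq ha.ne' hb.ne' hz h1 h2 T fun i => (hzT i).symm).symm⟩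
  · rintro ⟨l, hl, rfl⟩
    obtain ⟨z, hz, hinj, h1, h2, rfl⟩ := exists_selfPolar hg hl
    have hC : (2 * (1 - k * (a ^ 2 + b ^ 2) : ℝ) : ℂ) = (k * (a ^ 2 - b ^ 2) : ℝ) ^ 2 - 1 := by
      have : 2 * (1 - k * (a ^ 2 + b ^ 2)) = (k * (a ^ 2 - b ^ 2)) ^ 2 - 1 := by
        linear_combination -hroot
      exact_mod_cast this
    have hp (i j : Fin 3) (hij : z i ≠ z j) : z i ^ 2 + z j ^ 2 -
        (k * (a ^ 2 - b ^ 2) : ℝ) * (z i ^ 2 * z j ^ 2 + 1) =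
          2 * (1 - k * (a ^ 2 + b ^ 2) : ℝ) * (z i * z j) := by
      have p01 := polar_of_cubic h1 h2
      have p12 := polar_of_cubic (x := z 1) (y := z 2) (w := z 0)
        (by linear_combination h1) (by linear_combination h2)
      have p20 := polar_of_cubic (x := z 2) (y := z 0) (w := z 1)
        (by linear_combination h1) (by linear_combination h2)
      rw [hC]
      fin_cases i <;> fin_cases j <;> simp only [Fin.zero_eta, Fin.mk_one, Fin.reduceFinMk] at hij ⊢
      · exact absurd rfl hij
      · exact p01
      · linear_combination p20
      · linear_combination p01
      · exact absurd rfl hij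
      · exact p12
      · exact p20
      · linear_combination p12
      · exact absurd rfl hij
    refine ⟨⟨_, affineIndependent_ellipse ha.ne' hb.ne' hz hinj⟩,
      orbit_of_joachimsthal ha.ne' hb.ne' hz hinj hk fun i j hij => ?_,
      circumcenter_eq ha.ne' hb.ne' hz h1 h2 _ fun i => rfl⟩
    linear_combination -((polar_iff (hz i) (hz j) _ _).2 (hp i j hij))

lemma isCircle_ellipse (c : Plane) (e : OrthonormalBasis (Fin 2) ℝ Plane) {a : ℝ} (ha : 0 < a) :
    IsCircle (ellipse c e a a) := by
  refine ⟨c, a, ha, Set.ext fun p => ?_⟩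
  have key (z : ℂ) : ‖ellipseMap e a a z‖ = a * ‖z‖ := by
    refine (sq_eq_sq₀ (norm_nonneg _) (by positivity)).1 ?_
    rw [norm_sq_ellipseMap, mul_pow, Complex.sq_norm, normSq_apply]
    ring
  constructor
  · rintro ⟨z, hz, rfl⟩
    simp [key, hz]
  · intro hp
    obtain ⟨z, hz⟩ := exists_ellipseMap_eq e ha.ne' ha.ne' (p - c)
    refine ⟨z, ?_, by rw [hz]; abel⟩
    rw [mem_sphere_iff_norm, ← hz, key] at hp
    exact mul_left_cancel₀ ha.ne' (hp.trans (mul_one a).symm)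

end EllipticBilliard

theorem theorem1p22 (E : Set EllipticBilliard.Plane) (hE : EllipticBilliard.IsEllipse E) :
    (¬ EllipticBilliard.IsCircle E →
      EllipticBilliard.IsEllipse (EllipticBilliard.circumcenters E)) ∧
    (EllipticBilliard.IsCircle E → ∃ c, EllipticBilliard.circumcenters E = {c}) := by
  open EllipticBilliard in
  obtain ⟨c, e, a, b, ha, hb, rfl⟩ := hE
  rw [← ellipse_eq_setOf c e ha.ne' hb.ne']
  obtain ⟨g, hg, h⟩ := circumcenters_ellipse c e ha hb
  rw [abs_lt] at hg
  constructor
  · intro hcirc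
    have hd : a ^ 2 - b ^ 2 ≠ 0 := by
      intro hab
      obtain rfl : a = b := (sq_eq_sq₀ ha.le hb.le).1 (sub_eq_zero.1 hab)
      exact hcirc (isCircle_ellipse c e ha)
    rw [h]
    have h1 : 1 - g ≠ 0 := by linarith
    have h2 : 1 + g ≠ 0 := by linarith
    exact isEllipse_ellipse c e (by positivity) (by positivity)
  · rintro ⟨o, r, -, ho⟩
    refine ⟨o, Set.eq_singleton_iff_nonempty_unique_mem.2 ⟨?_, ?_⟩⟩
    · rw [h]
      exact ⟨_, 1, norm_one, rfl⟩
    · rintro _ ⟨T, hT, rfl⟩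
      rw [ho] at hT
      exact (T.eq_circumcenter_of_dist_eq (by rw [affineSpan_range_points_eq_top]; trivial) hT.1).symm
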